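/- Let $K$ be a field, let $(V,\omega)$ be a symplectic vector space over $K$ with $\dim_K V=2n$ (that is, $\omega$ is an alternating non-degenerate bilinear form on $V$), and for $M\in\operatorname{End}(V)$ let $M^{*\omega}$ denote the symplectic adjoint, determined by $\omega(Mv,w)=\omega(v,M^{*\omega}w)$ for all $v,w\in V$. A basis $(e_1,\dots,e_n,f_1,\dots,f_n)$ is called symplectic if $\omega(e_i,e_j)=\omega(f_i,f_j)=0$ and $\omega(e_i,f_j)=\delta_{ij}$ for all $i,j$. For an endomorphism $A$ of a symplectic vector space $(W,\omega)$ of dimension $2n$ over a field $F$ such that the form $\omega(\cdot,A\,\cdot)$ is alternating, let $\psi_A(t)\in F[t]$ be the Pfaffian of the alternating matrix $\bigl(\omega(v_i,Av_j)-t\,\omega(v_i,v_j)\bigr)_{1\le i,j\le 2n}$, where $(v_1,\dots,v_{2n})=(e_1,f_1,\dots,e_n,f_n)$ for any symplectic basis $(e_1,\dots,e_n,f_1,\dots,f_n)$ of $W$ (the choice of the basis does not matter). The symplectic characteristic polynomial of $M\in\operatorname{End}(V)$ is $$p^{\omega}_M(s,t)=\psi_{(M-s)(M^{*\omega}-s)}(t),$$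 where $(M-s)(M^{*\omega}-s)$ is regarded as an endomorphism of $V\otimes_K K(s)$. **Theorem.** Let $M\in\operatorname{End}(V)$ be symplectically normal, i.e. $MM^{*\omega}=M^{*\omega}M$, and suppose that $$p^{\omega}_M(s,t)=\prod_{i=1}^n\{(\lambda_i-s)(\mu_i-s)-t\},\qquad \lambda_i,\mu_i\in K,$$ where the polynomials $(\lambda_i-s)(\mu_i-s)$ and $(\lambda_j-s)(\mu_j-s)$ in $s$ are different for $i\ne j$. Then there is a symplectic basis $(e_1,\dots,e_n,f_1,\dots,f_n)$ of $V$ such that, for every $i\in\{1,\dots,n\}$, $$MM^{*\omega}e_i=\lambda_i\mu_i e_i,\quad (M+M^{*\omega})e_i=(\lambda_i+\mu_i)e_i,\quad MM^{*\omega}f_i=\lambda_i\mu_i f_i,\quad (M+M^{*\omega})f_i=(\lambda_i+\mu_i)f_i.$$ -/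

import Mathlib

open Polynomial TensorProduct

noncomputable section

namespace SymplLin

section Basic

variable {F W : Type*} [Field F] [AddCommGroup W] [Module F W]

/-- A symplectic form on a (finite-dimensional) vector space: an alternating bilinear form `ω` such
that `ω♭ : W → W*`, `v ↦ ω(·, v)` (which is `ω.flip`), is an isomorphism. -/
structure IsSymplectic (ω : LinearMap.BilinForm F W) : Prop where
  alt : ∀ v, ω v v = 0
  flat_bijective : Function.Bijective ω.flip

/-- The isomorphism `ω♭ : W → W*`, `v ↦ ω(·, v)`. -/
def flat (ω : LinearMap.BilinForm F W) (hω : IsSymplectic ω) : W ≃ₗ[F] Module.Dual F W :=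
  LinearEquiv.ofBijective ω.flip hω.flat_bijective

/-- The symplectic adjoint `M^{*ω} = (ω♭)⁻¹ ∘ M* ∘ ω♭` of `M`, with `M*` the dual map. -/
def symplAdjoint (ω : LinearMap.BilinForm F W) (hω : IsSymplectic ω) (M : Module.End F W) :
    Module.End F W :=
  (flat ω hω).symm.toLinearMap ∘ₗ LinearMap.dualMap M ∘ₗ (flat ω hω).toLinearMap

theorem apply_symplAdjoint (ω : LinearMap.BilinForm F W) (hω : IsSymplectic ω)
    (M : Module.End F W) (v w : W) : ω (M v) w = ω v (symplAdjoint ω hω M w) := by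
  have h : flat ω hω (symplAdjoint ω hω M w) = LinearMap.dualMap M (flat ω hω w) := by
    simp [symplAdjoint]
  exact (LinearMap.congr_fun h v).symm

/-- The relations of a symplectic basis `(e_1, …, e_n, f_1, …, f_n)`, where
`e_i = b (Sum.inl i)` and `f_i = b (Sum.inr i)`. -/
structure IsSymplecticFamily (ω : LinearMap.BilinForm F W) {n : ℕ} (b : Fin n ⊕ Fin n → W) :
    Prop where
  e_e : ∀ i j, ω (b (Sum.inl i)) (b (Sum.inl j)) = 0
  f_f : ∀ i j, ω (b (Sum.inr i)) (b (Sum.inr j)) = 0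
  e_f : ∀ i j, ω (b (Sum.inl i)) (b (Sum.inr j)) = if i = j then 1 else 0

theorem neg_swap {ω : LinearMap.BilinForm F W} (h : ∀ v, ω v v = 0) (v w : W) :
    ω v w = - ω w v := by
  have := h (v + w)
  simp only [map_add, LinearMap.add_apply, h] at this
  linear_combination this

theorem IsSymplecticFamily.f_e {ω : LinearMap.BilinForm F W} (h : ∀ v, ω v v = 0) {n : ℕ}
    {b : Fin n ⊕ Fin n → W} (hb : IsSymplecticFamily ω b) (i j : Fin n) :
    ω (b (Sum.inr i)) (b (Sum.inl j)) = if i = j then -1 else 0 := by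
  rw [neg_swap h, hb.e_f]
  by_cases hij : i = j
  · simp [hij]
  · simp [hij, Ne.symm hij]

theorem IsSymplecticFamily.linearIndependent {ω : LinearMap.BilinForm F W}
    (h : ∀ v, ω v v = 0) {n : ℕ} {b : Fin n ⊕ Fin n → W} (hb : IsSymplecticFamily ω b) :
    LinearIndependent F b := by
  rw [Fintype.linearIndependent_iff]
  intro g hg
  rw [Fintype.sum_sum_type] at hg
  rintro (i | i)
  · have := congrArg (fun x => ω x (b (Sum.inr i))) hg
    simpa [hb.e_f, hb.f_f] using this
  · have := congrArg (fun x => ω x (b (Sum.inl i))) hg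
    simpa [hb.e_e, hb.f_e h] using this

/-- Subtracting its components, a vector becomes orthogonal to a symplectic family. -/
theorem IsSymplecticFamily.exists_orthogonal {ω : LinearMap.BilinForm F W}
    (h : ∀ v, ω v v = 0) {n : ℕ} {b : Fin n ⊕ Fin n → W} (hb : IsSymplecticFamily ω b) (v : W) :
    ∃ u ∈ Submodule.span F (Set.range b), ∀ k, ω (v - u) (b k) = 0 := by
  refine ⟨∑ i, ω v (b (Sum.inr i)) • b (Sum.inl i) - ∑ i, ω v (b (Sum.inl i)) • b (Sum.inr i),
    ?_, ?_⟩
  · refine Submodule.sub_mem _ (Submodule.sum_mem _ fun i _ => ?_)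
      (Submodule.sum_mem _ fun i _ => ?_) <;>
      exact Submodule.smul_mem _ _ (Submodule.subset_span ⟨_, rfl⟩)
  · rintro (k | k)
    · simp [hb.e_e, hb.f_e h]
    · simp [hb.e_f, hb.f_f]

theorem exists_isSymplecticFamily [FiniteDimensional F W] (ω : LinearMap.BilinForm F W)
    (hω : IsSymplectic ω) :
    ∃ (n : ℕ) (b : Module.Basis (Fin n ⊕ Fin n) F W), IsSymplecticFamily ω b := by
  classical
  have hbound : ∀ n, (∃ b : Fin n ⊕ Fin n → W, IsSymplecticFamily ω b) →
      n ≤ Module.finrank F W := by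
    rintro n ⟨b, hb⟩
    have := (hb.linearIndependent hω.alt).fintype_card_le_finrank
    simp at this
    omega
  have h0 : ∃ b : Fin 0 ⊕ Fin 0 → W, IsSymplecticFamily ω b :=
    ⟨fun _ => 0, ⟨fun i => i.elim0, fun i => i.elim0, fun i => i.elim0⟩⟩
  obtain ⟨n, ⟨b, hb⟩, hmax⟩ : ∃ n, (∃ b : Fin n ⊕ Fin n → W, IsSymplecticFamily ω b) ∧
      ¬ ∃ b : Fin (n + 1) ⊕ Fin (n + 1) → W, IsSymplecticFamily ω b := by
    by_contra! hcon
    have hall : ∀ n, ∃ b : Fin n ⊕ Fin n → W, IsSymplecticFamily ω b := by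
      intro n
      induction n with
      | zero => exact h0
      | succ k ih => obtain ⟨b, hb⟩ := ih; exact hcon k ⟨b, hb⟩
    have := hbound _ (hall (Module.finrank F W + 1))
    omega
  have hli := hb.linearIndependent hω.alt
  have hspan : ⊤ ≤ Submodule.span F (Set.range b) := by
    by_contra hns
    obtain ⟨v, -, hv⟩ := SetLike.not_le_iff_exists.1 hns
    obtain ⟨u, hu, huv⟩ := hb.exists_orthogonal hω.alt v
    have hx0 : v - u ≠ 0 := by
      intro h
      rw [sub_eq_zero] at h
      exact hv (h ▸ hu)
    obtain ⟨w, hw⟩ : ∃ w, ω (v - u) w ≠ 0 := by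
      by_contra! hcon
      apply hx0
      apply hω.flat_bijective.1
      ext w
      simp [neg_swap hω.alt w, hcon w, -map_sub]
    obtain ⟨u', hu', huw⟩ := hb.exists_orthogonal hω.alt ((ω (v - u) w)⁻¹ • w)
    have hperp : ∀ z ∈ Submodule.span F (Set.range b), ω (v - u) z = 0 := by
      intro z hz
      induction hz using Submodule.span_induction with
      | mem z hz => obtain ⟨k, rfl⟩ := hz; exact huv k
      | zero => simp
      | add x y _ _ hx hy => rw [map_add, hx, hy, add_zero]
      | smul a x _ hx => rw [map_smul, hx, smul_zero]
    set x := v - u with hx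
    set y := (ω x w)⁻¹ • w - u' with hy
    have hxy : ω x y = 1 := by
      rw [hy, map_sub, hperp u' hu', map_smul, smul_eq_mul, sub_zero, inv_mul_cancel₀ hw]
    have hbx : ∀ k, ω (b k) x = 0 := fun k => by rw [neg_swap hω.alt, huv, neg_zero]
    have hby : ∀ k, ω (b k) y = 0 := fun k => by rw [neg_swap hω.alt, huw, neg_zero]
    apply hmax
    refine ⟨Sum.elim (Fin.cons x fun i => b (Sum.inl i)) (Fin.cons y fun i => b (Sum.inr i)),
      ⟨?_, ?_, ?_⟩⟩
    · intro i j
      refine Fin.cases ?_ (fun i => ?_) i <;> refine Fin.cases ?_ (fun j => ?_) j <;>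
        simp [hω.alt, huv, hbx, hb.e_e]
    · intro i j
      refine Fin.cases ?_ (fun i => ?_) i <;> refine Fin.cases ?_ (fun j => ?_) j <;>
        simp [hω.alt, huw, hby, hb.f_f]
    · intro i j
      refine Fin.cases ?_ (fun i => ?_) i <;> refine Fin.cases ?_ (fun j => ?_) j <;>
        simp [hxy, huv, hby, hb.e_f, Fin.succ_ne_zero, (Fin.succ_ne_zero _).symm]
  refine ⟨n, Module.Basis.mk hli hspan, ?_⟩
  simpa using hb

theorem exists_symplecticBasis [FiniteDimensional F W] (ω : LinearMap.BilinForm F W)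
    (hω : IsSymplectic ω) :
    ∃ b : Module.Basis (Fin (Module.finrank F W / 2) ⊕ Fin (Module.finrank F W / 2)) F W,
      IsSymplecticFamily ω b := by
  obtain ⟨n, b, hb⟩ := exists_isSymplecticFamily ω hω
  have hn : n = Module.finrank F W / 2 := by
    have := Module.finrank_eq_card_basis b
    simp at this
    omega
  subst hn
  exact ⟨b, hb⟩

theorem IsSymplectic.of_basis {ω : LinearMap.BilinForm F W} (h : ∀ v, ω v v = 0)
    {n : ℕ} (b : Module.Basis (Fin n ⊕ Fin n) F W) (hb : IsSymplecticFamily ω b) :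
    IsSymplectic ω := by
  have : FiniteDimensional F W := b.finiteDimensional_of_finite
  have hinj : Function.Injective ω.flip := by
    rw [injective_iff_map_eq_zero]
    intro v hv
    have hv' : ∀ k, ω (b k) v = 0 := fun k => LinearMap.congr_fun hv (b k)
    rw [← b.sum_repr v, Fintype.sum_sum_type] at hv'
    apply b.repr.injective
    ext k
    rcases k with k | k
    · simpa [hb.f_e h, hb.f_f] using hv' (Sum.inr k)
    · simpa [hb.e_e, hb.e_f] using hv' (Sum.inl k)
  exact ⟨h, hinj, (LinearMap.injective_iff_surjective_of_finrank_eq_finrank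
    (Subspace.dual_finrank_eq (K := F) (V := W)).symm).1 hinj⟩

end Basic

/-- The extension of a symplectic form to `L ⊗ W`, for a field extension `L / F`, is symplectic. -/
theorem IsSymplectic.baseChange {F W : Type*} (L : Type*) [Field F] [Field L] [Algebra F L]
    [AddCommGroup W] [Module F W] [FiniteDimensional F W] {ω : LinearMap.BilinForm F W}
    (hω : IsSymplectic ω) : IsSymplectic (ω.baseChange L) := by
  have hskew : ∀ x y : L ⊗[F] W, ω.baseChange L x y = - ω.baseChange L y x := by
    intro x y
    induction x with
    | zero => simp
    | add x₁ x₂ h₁ h₂ => simp only [map_add, LinearMap.add_apply, h₁, h₂, neg_add]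
    | tmul a v =>
      induction y with
      | zero => simp
      | add y₁ y₂ h₁ h₂ => simp only [map_add, LinearMap.add_apply, h₁, h₂, neg_add]
      | tmul c w =>
        rw [LinearMap.BilinForm.baseChange_tmul, LinearMap.BilinForm.baseChange_tmul,
          neg_swap hω.alt v w, neg_smul, mul_comm a c]
  have halt : ∀ x, ω.baseChange L x x = 0 := by
    intro x
    induction x with
    | zero => simp
    | add x₁ x₂ h₁ h₂ =>
      simp only [map_add, LinearMap.add_apply, h₁, h₂, hskew x₁ x₂]
      ring
    | tmul a v => rw [LinearMap.BilinForm.baseChange_tmul, hω.alt, zero_smul]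
  obtain ⟨n, b, hb⟩ := exists_isSymplecticFamily ω hω
  refine IsSymplectic.of_basis halt (b.baseChange L) ⟨?_, ?_, ?_⟩ <;> intro i j <;>
    simp only [Module.Basis.baseChange_apply, LinearMap.BilinForm.baseChange_tmul, hb.e_e, hb.f_f,
      hb.e_f] <;> simp

/-- The Pfaffian of an alternating matrix of size `2n`: the sum over all perfect matchings of the
index set. The indices `(0, 0), (0, 1), (1, 0), (1, 1), …, (n - 1, 0), (n - 1, 1)` are listed in
this (lexicographic) order, and a matching is written uniquely as `{σ (i, 0), σ (i, 1)}`,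
`i = 0, …, n - 1`, with `σ (i, 0) < σ (i, 1)` and `σ (0, 0) < σ (1, 0) < … < σ (n - 1, 0)`. -/
def pfaffian {R : Type*} [CommRing R] {n : ℕ} (A : Matrix (Fin n × Fin 2) (Fin n × Fin 2) R) : R :=
  ∑ σ : Equiv.Perm (Fin n × Fin 2) with
      (∀ i, toLex (σ (i, 0)) < toLex (σ (i, 1))) ∧
      (∀ i j, i < j → toLex (σ (i, 0)) < toLex (σ (j, 0))),
    ((Equiv.Perm.sign σ : ℤ) : R) * ∏ i, A (σ (i, 0)) (σ (i, 1))

section Psi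

variable {F W : Type*} [Field F] [AddCommGroup W] [Module F W] [FiniteDimensional F W]

/-- A symplectic basis listed as `(v_1, …, v_{2n}) = (e_1, f_1, …, e_n, f_n)`: the vector at
`(i, 0)` is `e_i`, the vector at `(i, 1)` is `f_i`. -/
def interleave {n : ℕ} (b : Fin n ⊕ Fin n → W) (k : Fin n × Fin 2) : W :=
  if k.2 = 0 then b (Sum.inl k.1) else b (Sum.inr k.1)

/-- The polynomial `ψ_A(t) = Pf_ω(ω_{A - t})`, where `ω_B(v, w) = ω(v, B w)`, for an endomorphism
`A` such that `ω_A` is alternating. It is the Pfaffian of the matrix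
`(ω(v_i, A v_j) - t ω(v_i, v_j))` over `F[t]`, for a symplectic basis `(e_1, f_1, …, e_n, f_n)`
listed as `(v_1, …, v_{2n})`; since symplectic maps have determinant `1`, the choice of the
symplectic basis does not matter. -/
def psi (ω : LinearMap.BilinForm F W) (hω : IsSymplectic ω) (A : Module.End F W) : F[X] :=
  let v := interleave (exists_symplecticBasis ω hω).choose
  pfaffian (Matrix.of fun k l => C (ω (v k) (A (v l))) - X * C (ω (v k) (v l)))

end Psi

section SymplCharpoly

variable {K V : Type*} [Field K] [AddCommGroup V] [Module K V] [FiniteDimensional K V]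

/-- The endomorphism `(M - s)(M^{*ω} - s)` of `K(s) ⊗ V`, with `s` the variable of the field
`K(s)` of rational functions. -/
def symplPencil (ω : LinearMap.BilinForm K V) (hω : IsSymplectic ω) (M : Module.End K V) :
    Module.End (RatFunc K) (RatFunc K ⊗[K] V) :=
  (LinearMap.baseChange (RatFunc K) M - (RatFunc.X : RatFunc K) • LinearMap.id) ∘ₗ
    (LinearMap.baseChange (RatFunc K) (symplAdjoint ω hω M) -
      (RatFunc.X : RatFunc K) • LinearMap.id)

/-- The symplectic characteristic polynomial of `M`, i.e. `ψ_{(M - s)(M^{*ω} - s)}(t)`: a polynomial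
in the variable `t`, with coefficients in `K(s)`. -/
def symplCharpoly (ω : LinearMap.BilinForm K V) (hω : IsSymplectic ω) (M : Module.End K V) :
    (RatFunc K)[X] :=
  psi (ω.baseChange (RatFunc K)) (hω.baseChange (RatFunc K)) (symplPencil ω hω M)

/-- `M` is symplectically normal if `M M^{*ω} = M^{*ω} M`. -/
def IsSymplecticallyNormal (ω : LinearMap.BilinForm K V) (hω : IsSymplectic ω)
    (M : Module.End K V) : Prop :=
  M * symplAdjoint ω hω M = symplAdjoint ω hω M * M

end SymplCharpoly

/-- The polynomial `(a - s)(b - s)`, as an element of `K(s)`. -/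
def quad {K : Type*} [Field K] (a b : K) : RatFunc K :=
  (RatFunc.C a - RatFunc.X) * (RatFunc.C b - RatFunc.X)

end SymplLin

end

/-!
Put `N = M M^{*ω}` and `P = M + M^{*ω}`. Both are self-adjoint for `ω`, with `ω(·, N ·)` and
`ω(·, P ·)` alternating, they commute because `M` is symplectically normal, and the pencil is
`A = N - s P + s²` over `K(s)`.

The square of a Pfaffian is a determinant (`pfaffian_sq`), so `ψ_A(t)²` is the characteristic
polynomial of `A` (`psi_sq`). As the factors `(λ_i - s)(μ_i - s) - t` are distinct, every
`(λ_i - s)(μ_i - s)` is an eigenvalue of `A` with a two-dimensional generalized eigenspace. The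
Fitting decomposition is orthogonal for a self-adjoint endomorphism, so `ω` does not vanish on that
plane; and on a symplectic plane an operator `T` with `ω(·, T ·)` alternating is scalar
(`IsAltSelfAdjoint.exists_pair_of_finrank_eq_two`). Hence `A`, `N` and `P` are scalar there.
The scalars of `N` and `P` are algebraic over `K`, so they lie in `K`
(`exists_eq_C_of_baseChange_apply`), and comparing coefficients of `s` in
`(λ_i - s)(μ_i - s) = ν - s π + s²` identifies them as `λ_i μ_i` and `λ_i + μ_i`.

Joint kernels commute with extension of scalars, so `ω` does not vanish on the joint eigenspace of
`N` and `P` in `V` itself (`exists_pair_of_symplCharpoly`), which provides `e_i` and `f_i` with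
`ω(e_i, f_i) = 1`. Joint eigenspaces for different `i` are orthogonal, so these vectors form a
symplectic family, which is a basis because it has `2n = dim V` members.

The identity `Pf² = det` is obtained for the generic alternating matrix over `ℤ`. There one may
divide by integers, and `2 ^ n * n !` times the Pfaffian is a signed sum over all permutations,
which is visibly multiplied by `det B` under a congruence `A ↦ B A Bᵀ`; over the fraction field a
symplectic basis provides a congruence to the standard Gram matrix.
-/

noncomputable section

namespace SymplLin

/-! ### Pfaffians of alternating matrices -/

section Pfaffian

variable {R S : Type*} [CommRing R] [CommRing S] {n : ℕ}

/-- The summand of the Pfaffian attached to a permutation of the indices. -/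
def pfaffianTerm (A : Matrix (Fin n × Fin 2) (Fin n × Fin 2) R)
    (σ : Equiv.Perm (Fin n × Fin 2)) : R :=
  ((Equiv.Perm.sign σ : ℤ) : R) * ∏ i, A (σ (i, 0)) (σ (i, 1))

/-- The sum of the Pfaffian summands over all permutations, so that each perfect matching is counted
`2 ^ n * n !` times. -/
def pfaffianFull (A : Matrix (Fin n × Fin 2) (Fin n × Fin 2) R) : R :=
  ∑ σ, pfaffianTerm A σ

/-- The permutations that list a perfect matching in normal form; `pfaffian` sums over them. -/
abbrev IsMatchingNormal (σ : Equiv.Perm (Fin n × Fin 2)) : Prop :=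
  (∀ i, toLex (σ (i, 0)) < toLex (σ (i, 1))) ∧ ∀ i j, i < j → toLex (σ (i, 0)) < toLex (σ (j, 0))

theorem pfaffian_map (f : R →+* S) (A : Matrix (Fin n × Fin 2) (Fin n × Fin 2) R) :
    pfaffian (A.map f) = f (pfaffian A) := by
  simp [pfaffian, map_sum, map_mul, map_prod]

/-- The permutation `(i, c) ↦ (τ i, ε i c)`, which preserves the matching `{(i, 0), (i, 1)}`. -/
def matchingStab (h : (Fin n → Equiv.Perm (Fin 2)) × Equiv.Perm (Fin n)) :
    Equiv.Perm (Fin n × Fin 2) :=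
  (Equiv.prodCongrLeft fun _ : Fin 2 => h.2) * Equiv.prodCongrRight h.1

@[simp]
theorem matchingStab_apply (h : (Fin n → Equiv.Perm (Fin 2)) × Equiv.Perm (Fin n)) (i : Fin n)
    (c : Fin 2) : matchingStab h (i, c) = (h.2 i, h.1 i c) := rfl

theorem sign_matchingStab (h : (Fin n → Equiv.Perm (Fin 2)) × Equiv.Perm (Fin n)) :
    Equiv.Perm.sign (matchingStab h) = ∏ i, Equiv.Perm.sign (h.1 i) := by
  rw [matchingStab, map_mul, Equiv.Perm.sign_prodCongrLeft, Equiv.Perm.sign_prodCongrRight,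
    Fin.prod_univ_two, Int.units_mul_self, one_mul]

theorem perm_fin_two (ε : Equiv.Perm (Fin 2)) : ε = 1 ∨ ε = Equiv.swap 0 1 := by
  revert ε; decide

theorem pfaffianTerm_mul_matchingStab {A : Matrix (Fin n × Fin 2) (Fin n × Fin 2) R}
    (hA : ∀ k l, A k l = -A l k) (σ : Equiv.Perm (Fin n × Fin 2))
    (h : (Fin n → Equiv.Perm (Fin 2)) × Equiv.Perm (Fin n)) :
    pfaffianTerm A (σ * matchingStab h) = pfaffianTerm A σ := by
  have key : ∀ i, ((Equiv.Perm.sign (h.1 i) : ℤ) : R) *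
      A (σ (h.2 i, h.1 i 0)) (σ (h.2 i, h.1 i 1)) = A (σ (h.2 i, 0)) (σ (h.2 i, 1)) := by
    intro i
    rcases perm_fin_two (h.1 i) with h | h
    · simp [h]
    · simp [h, ← hA]
  simp only [pfaffianTerm, map_mul, sign_matchingStab, Units.val_mul, Int.cast_mul,
    Equiv.Perm.coe_mul, Function.comp_apply, matchingStab_apply, Units.coe_prod, Int.cast_prod]
  rw [mul_assoc, ← Finset.prod_mul_distrib, Finset.prod_congr rfl fun i _ => key i,
    Equiv.prod_comp h.2 fun i => A (σ (i, 0)) (σ (i, 1))]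

/-- Every permutation is, in exactly one way, a matching in normal form precomposed with a
permutation of the pairs and of the two members of each pair. -/
theorem matchingStab_bijective :
    Function.Bijective fun p : {σ : Equiv.Perm (Fin n × Fin 2) // IsMatchingNormal σ} ×
      ((Fin n → Equiv.Perm (Fin 2)) × Equiv.Perm (Fin n)) => p.1.1 * matchingStab p.2 := by
  constructor
  · rintro ⟨⟨σ, hσ, hσ'⟩, ε, τ⟩ ⟨⟨ρ, hρ, hρ'⟩, ε', τ'⟩ h
    have h' : ∀ i c, σ (τ i, ε i c) = ρ (τ' i, ε' i c) := fun i c => by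
      simpa using DFunLike.congr_fun h (i, c)
    -- `ε i` records which of the two entries of the `i`-th pair is the smaller one.
    have hε : ε = ε' := by
      funext i
      have h0 := h' i 0
      have h1 := h' i 1
      have a := hσ (τ i)
      have b := hρ (τ' i)
      rcases perm_fin_two (ε i) with e | e <;> rcases perm_fin_two (ε' i) with e' | e'
      · exact e.trans e'.symm
      · simp only [e, e', Equiv.Perm.one_apply, Equiv.swap_apply_left, Equiv.swap_apply_right]
          at h0 h1
        rw [h0, h1] at a
        exact absurd a b.asymm
      · simp only [e, e', Equiv.Perm.one_apply, Equiv.swap_apply_left, Equiv.swap_apply_right]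
          at h0 h1
        rw [h0, h1] at a
        exact absurd a b.asymm
      · exact e.trans e'.symm
    subst hε
    have h0 : ∀ i c, σ (τ i, c) = ρ (τ' i, c) := fun i c => by simpa using h' i ((ε i)⁻¹ c)
    have hF : (fun i => toLex (σ (i, 0))) = fun i => toLex (ρ (i, 0)) := by
      refine (StrictMono.range_inj (fun i j => hσ' i j) (fun i j => hρ' i j)).1 ?_
      rw [← τ.surjective.range_comp, ← τ'.surjective.range_comp fun i => toLex (ρ (i, 0))]
      congr 1
      funext i
      exact congrArg toLex (h0 i 0)
    have hτ : τ = τ' := by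
      ext1 i
      have h1 : σ (τ' i, 0) = ρ (τ' i, 0) := toLex.injective (congrFun hF (τ' i))
      simpa using σ.injective ((h0 i 0).trans h1.symm)
    subst hτ
    have hσρ : σ = ρ := by
      ext1 ⟨i, c⟩
      simpa using h0 (τ⁻¹ i) c
    subst hσρ
    rfl
  · intro ρ
    have hε : ∀ i, ∃ e : Equiv.Perm (Fin 2), toLex (ρ (i, e 0)) < toLex (ρ (i, e 1)) := by
      intro i
      rcases lt_trichotomy (toLex (ρ (i, 0))) (toLex (ρ (i, 1))) with h | h | h
      · exact ⟨1, h⟩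
      · simp at h
      · exact ⟨Equiv.swap 0 1, by simpa using h⟩
    choose ε hε using hε
    let g : Fin n → Lex (Fin n × Fin 2) := fun i => toLex (ρ (i, ε i 0))
    have hg : Function.Injective g := fun i j hij => (Prod.ext_iff.1 (ρ.injective hij)).1
    have hmono : StrictMono (g ∘ Tuple.sort g) :=
      (Tuple.monotone_sort g).strictMono_of_injective (hg.comp (Tuple.sort g).injective)
    refine ⟨⟨⟨ρ * (matchingStab (fun i => (ε i)⁻¹, (Tuple.sort g)⁻¹))⁻¹, ?_⟩, _⟩,
      inv_mul_cancel_right _ _⟩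
    have hinv : ∀ i c, (matchingStab (fun i => (ε i)⁻¹, (Tuple.sort g)⁻¹))⁻¹ (i, c) =
        (Tuple.sort g i, ε (Tuple.sort g i) c) := by
      intro i c
      rw [Equiv.Perm.inv_eq_iff_eq]
      simp
    simp only [IsMatchingNormal, Equiv.Perm.coe_mul, Function.comp_apply, hinv]
    exact ⟨fun i => hε _, fun i j hij => hmono hij⟩

theorem pfaffianFull_eq {A : Matrix (Fin n × Fin 2) (Fin n × Fin 2) R}
    (hA : ∀ k l, A k l = -A l k) :
    pfaffianFull A =
      Fintype.card ((Fin n → Equiv.Perm (Fin 2)) × Equiv.Perm (Fin n)) * pfaffian A := by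
  rw [pfaffianFull, ← (Equiv.ofBijective _ matchingStab_bijective).sum_comp, Fintype.sum_prod_type]
  simp only [Equiv.ofBijective_apply, pfaffianTerm_mul_matchingStab hA, Finset.sum_const,
    Finset.card_univ, nsmul_eq_mul]
  rw [← Finset.mul_sum, pfaffian, ← Finset.sum_subtype_eq_sum_filter, Finset.subtype_univ]
  rfl

/-- The full signed sum is multiplied by the determinant under a congruence: expanding the entries
of `B * A * Bᵀ` leaves, for each choice `g` of inner indices, the determinant of the columns of `B`
selected by `g`, which vanishes unless `g` is a permutation. -/
theorem pfaffianFull_congruence (A B : Matrix (Fin n × Fin 2) (Fin n × Fin 2) R) :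
    pfaffianFull (B * A * B.transpose) = B.det * pfaffianFull A := by
  have hexp : ∀ σ : Equiv.Perm (Fin n × Fin 2),
      ∏ i, (B * A * B.transpose) (σ (i, 0)) (σ (i, 1)) =
        ∑ g : Fin n × Fin 2 → Fin n × Fin 2,
          (∏ i, A (g (i, 0)) (g (i, 1))) * ∏ x, B (σ x) (g x) := by
    intro σ
    have h1 : ∀ p q, (B * A * B.transpose) p q =
        ∑ f : Fin 2 → Fin n × Fin 2, A (f 0) (f 1) * (B p (f 0) * B q (f 1)) := by
      intro p q
      rw [← (finTwoArrowEquiv (Fin n × Fin 2)).symm.sum_comp, Fintype.sum_prod_type_right]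
      simp only [Matrix.mul_apply, Matrix.transpose_apply, Finset.sum_mul]
      refine Finset.sum_congr rfl fun l _ => Finset.sum_congr rfl fun k _ => ?_
      simp
      ring
    simp only [h1]
    rw [Finset.prod_univ_sum, Fintype.piFinset_univ,
      ← (Equiv.curry (Fin n) (Fin 2) (Fin n × Fin 2)).sum_comp]
    refine Finset.sum_congr rfl fun g _ => ?_
    rw [Finset.prod_mul_distrib, Fintype.prod_prod_type]
    simp [Fin.prod_univ_two, Function.curry]
  have hcol : ∀ g : Fin n × Fin 2 → Fin n × Fin 2,
      ∑ σ : Equiv.Perm (Fin n × Fin 2), ((Equiv.Perm.sign σ : ℤ) : R) * ∏ x, B (σ x) (g x) =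
        (B.submatrix id g).det := fun g => by
    rw [Matrix.det_apply']
    rfl
  calc pfaffianFull (B * A * B.transpose)
      = ∑ g : Fin n × Fin 2 → Fin n × Fin 2,
          (∏ i, A (g (i, 0)) (g (i, 1))) * (B.submatrix id g).det := by
        simp only [pfaffianFull, pfaffianTerm, hexp, Finset.mul_sum]
        rw [Finset.sum_comm]
        refine Finset.sum_congr rfl fun g _ => ?_
        rw [← hcol, Finset.mul_sum]
        exact Finset.sum_congr rfl fun σ _ => by ring
    _ = ∑ σ : Equiv.Perm (Fin n × Fin 2),
          (∏ i, A (σ (i, 0)) (σ (i, 1))) * (B.submatrix id σ).det := by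
        refine (Finset.sum_of_injOn (fun σ : Equiv.Perm (Fin n × Fin 2) => ⇑σ)
          DFunLike.coe_injective.injOn (by simp) ?_ (fun _ _ => rfl)).symm
        intro g _ hg
        have hni : ¬ Function.Injective g := fun hinj => hg
          ⟨Equiv.ofBijective g (Finite.injective_iff_bijective.1 hinj), by simp, rfl⟩
        simp only [Function.Injective, not_forall] at hni
        obtain ⟨a, b, hab, hne⟩ := hni
        rw [Matrix.det_zero_of_column_eq hne fun i => by simp [hab], mul_zero]
    _ = B.det * pfaffianFull A := by
        rw [pfaffianFull, Finset.mul_sum]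
        refine Finset.sum_congr rfl fun σ _ => ?_
        rw [Matrix.det_permute', pfaffianTerm]
        ring

/-- The Gram matrix of a symplectic basis listed as `(e_1, f_1, …, e_n, f_n)`. -/
def stdGram (R : Type*) [CommRing R] (n : ℕ) : Matrix (Fin n × Fin 2) (Fin n × Fin 2) R :=
  (Matrix.blockDiagonal fun _ : Fin n => !![0, 1; -1, 0]).submatrix
    (Equiv.prodComm (Fin n) (Fin 2)) (Equiv.prodComm (Fin n) (Fin 2))

theorem stdGram_apply (k l : Fin n × Fin 2) :
    stdGram R n k l = if k.1 = l.1 then (!![0, 1; -1, 0] : Matrix (Fin 2) (Fin 2) R) k.2 l.2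
      else 0 := by
  simp [stdGram, Matrix.blockDiagonal_apply]

theorem det_stdGram : (stdGram R n).det = 1 := by
  rw [stdGram, Matrix.det_submatrix_equiv_self, Matrix.det_blockDiagonal]
  simp

theorem stdGram_neg_swap (k l : Fin n × Fin 2) : stdGram R n k l = -stdGram R n l k := by
  obtain ⟨i, c⟩ := k
  obtain ⟨j, d⟩ := l
  rw [stdGram_apply, stdGram_apply]
  by_cases h : i = j
  · subst h
    fin_cases c <;> fin_cases d <;> simp
  · simp [h, Ne.symm h]

theorem pfaffian_stdGram : pfaffian (stdGram R n) = 1 := by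
  rw [pfaffian, Finset.sum_eq_single 1]
  · simp [stdGram_apply]
  · intro σ hσ hne
    rw [Finset.mem_filter] at hσ
    obtain ⟨-, hσ, hσ'⟩ := hσ
    -- A nonzero summand forces `σ` to preserve every pair, hence to be the identity.
    by_contra hterm
    apply hne
    have hblock : ∀ i, (σ (i, 0)).1 = (σ (i, 1)).1 := by
      intro i
      by_contra hi
      apply hterm
      rw [Finset.prod_eq_zero (Finset.mem_univ i) (by rw [stdGram_apply, if_neg hi]), mul_zero]
    have hsnd : ∀ i, (σ (i, 0)).2 = 0 ∧ (σ (i, 1)).2 = 1 := by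
      intro i
      have := hσ i
      rw [Prod.Lex.toLex_lt_toLex] at this
      have := this.resolve_left (by simp [hblock i])
      omega
    have hmono : StrictMono fun i => (σ (i, 0)).1 := by
      intro i j hij
      have := hσ' i j hij
      rw [Prod.Lex.toLex_lt_toLex] at this
      exact this.resolve_right (by simp [(hsnd i).1, (hsnd j).1])
    have hid : ∀ i, (σ (i, 0)).1 = i := by
      have h1 : (fun i => (σ (i, 0)).1) = id := by
        refine (StrictMono.range_inj hmono strictMono_id).1 ?_
        rw [Set.range_id, (Finite.injective_iff_surjective.1 hmono.injective).range_eq]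
      exact fun i => congrFun h1 i
    ext1 ⟨i, c⟩
    fin_cases c
    · exact Prod.ext (hid i) (hsnd i).1
    · exact Prod.ext ((hblock i).symm.trans (hid i)) (hsnd i).2
  · intro h
    exact absurd (Finset.mem_filter.2 ⟨Finset.mem_univ _, by simp [Prod.Lex.toLex_lt_toLex],
      fun i j hij => by simp [Prod.Lex.toLex_lt_toLex, hij]⟩) h

end Pfaffian

theorem IsSymplecticFamily.gram_interleave {F W : Type*} [Field F] [AddCommGroup W] [Module F W]
    {ω : LinearMap.BilinForm F W} (h : ∀ v, ω v v = 0) {n : ℕ} {b : Fin n ⊕ Fin n → W}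
    (hb : IsSymplecticFamily ω b) (k l : Fin n × Fin 2) :
    ω (interleave b k) (interleave b l) = stdGram F n k l := by
  obtain ⟨i, c⟩ := k
  obtain ⟨j, d⟩ := l
  fin_cases c <;> fin_cases d <;>
    simp [interleave, stdGram_apply, hb.e_e, hb.f_f, hb.e_f, hb.f_e h]

section PfaffianSq

variable {n : ℕ}

theorem pfaffian_sq_of_det_ne_zero {F : Type*} [Field F] [CharZero F]
    {A : Matrix (Fin n × Fin 2) (Fin n × Fin 2) F} (hA : ∀ k l, A k l = -A l k)
    (hdet : A.det ≠ 0) : pfaffian A ^ 2 = A.det := by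
  have happ : ∀ v w, Matrix.toBilin' A v w = v ⬝ᵥ A.mulVec w := fun v w =>
    Matrix.toBilin'_apply' A v w
  have halt : ∀ v, Matrix.toBilin' A v v = 0 := by
    intro v
    have hT : A.transpose = -A := by
      ext k l
      simp [hA l k]
    have h1 : v ⬝ᵥ A.mulVec v = -(v ⬝ᵥ A.mulVec v) := by
      conv_lhs => rw [Matrix.dotProduct_mulVec, dotProduct_comm, ← Matrix.mulVec_transpose, hT,
        Matrix.neg_mulVec, dotProduct_neg]
    rw [happ]
    linear_combination (1 / 2 : F) * h1
  have hinj : Function.Injective (Matrix.toBilin' A).flip := by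
    rw [injective_iff_map_eq_zero]
    intro w hw
    apply Matrix.eq_zero_of_mulVec_eq_zero hdet
    rw [← dotProduct_eq_zero_iff]
    intro v
    rw [dotProduct_comm, ← happ]
    exact LinearMap.congr_fun hw v
  have hω : IsSymplectic (Matrix.toBilin' A) := ⟨halt, hinj,
    (LinearMap.injective_iff_surjective_of_finrank_eq_finrank
      (Subspace.dual_finrank_eq (K := F) (V := Fin n × Fin 2 → F)).symm).1 hinj⟩
  obtain ⟨m, b, hb⟩ := exists_isSymplecticFamily _ hω
  obtain rfl : m = n := by
    have := Module.finrank_eq_card_basis b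
    simp at this
    omega
  let B : Matrix (Fin m × Fin 2) (Fin m × Fin 2) F := Matrix.of (interleave b)
  have hB : B * A * B.transpose = stdGram F m := by
    ext k l
    rw [← hb.gram_interleave halt, happ, Matrix.mul_assoc]
    rfl
  have h1 : B.det * pfaffian A = 1 := by
    have h2 := pfaffianFull_congruence A B
    rw [hB, pfaffianFull_eq stdGram_neg_swap, pfaffianFull_eq hA, pfaffian_stdGram] at h2
    have hc : (Fintype.card ((Fin m → Equiv.Perm (Fin 2)) × Equiv.Perm (Fin m)) : F) ≠ 0 :=
      Nat.cast_ne_zero.2 Fintype.card_ne_zero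
    apply mul_left_cancel₀ hc
    linear_combination -h2
  have h2 : B.det * A.det * B.det = 1 := by
    rw [← det_stdGram (R := F) (n := m), ← hB, Matrix.det_mul, Matrix.det_mul,
      Matrix.det_transpose]
  have h3 : B.det ≠ 0 := left_ne_zero_of_mul_eq_one h1
  apply mul_left_cancel₀ (mul_ne_zero h3 h3)
  linear_combination (B.det * pfaffian A + 1) * h1 - h2

/-- The alternating matrix whose entries above the diagonal are independent variables. -/
def genericAlternating (n : ℕ) : Matrix (Fin n × Fin 2) (Fin n × Fin 2)
    (MvPolynomial ((Fin n × Fin 2) × (Fin n × Fin 2)) ℤ) :=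
  Matrix.of fun k l => if toLex k < toLex l then MvPolynomial.X (k, l)
    else if toLex l < toLex k then -MvPolynomial.X (l, k) else 0

theorem genericAlternating_neg_swap (k l : Fin n × Fin 2) :
    genericAlternating n k l = -genericAlternating n l k := by
  rcases lt_trichotomy (toLex k) (toLex l) with h | h | h
  · simp [genericAlternating, h, h.asymm]
  · obtain rfl := toLex.injective h
    simp [genericAlternating]
  · simp [genericAlternating, h, h.asymm]

theorem genericAlternating_map {R : Type*} [CommRing R]
    {A : Matrix (Fin n × Fin 2) (Fin n × Fin 2) R} (hA : ∀ k l, A k l = -A l k)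
    (hA' : ∀ k, A k k = 0) :
    (genericAlternating n).map
      (MvPolynomial.eval₂Hom (Int.castRingHom R) fun p => A p.1 p.2) = A := by
  ext k l
  rcases lt_trichotomy (toLex k) (toLex l) with h | h | h
  · simp [genericAlternating, h]
  · obtain rfl := toLex.injective h
    simp [genericAlternating, hA']
  · simp [genericAlternating, h, h.asymm, ← hA]

/-- The square of the Pfaffian is the determinant, over any commutative ring: both sides are
specializations of the same identity for the generic alternating matrix, which is verified in the
fraction field of an integral polynomial ring, of characteristic zero. -/
theorem pfaffian_sq {R : Type*} [CommRing R] {A : Matrix (Fin n × Fin 2) (Fin n × Fin 2) R}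
    (hA : ∀ k l, A k l = -A l k) (hA' : ∀ k, A k k = 0) : pfaffian A ^ 2 = A.det := by
  let P := MvPolynomial ((Fin n × Fin 2) × (Fin n × Fin 2)) ℤ
  have hdet : (genericAlternating n).det ≠ 0 := by
    intro h0
    have h1 := congrArg (MvPolynomial.eval₂Hom (Int.castRingHom ℤ)
      fun p => stdGram ℤ n p.1 p.2) h0
    rw [RingHom.map_det, map_zero, RingHom.mapMatrix_apply,
      genericAlternating_map stdGram_neg_swap
        (fun k => by obtain ⟨i, c⟩ := k; fin_cases c <;> simp [stdGram_apply]),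
      det_stdGram] at h1
    exact one_ne_zero h1
  have hinj : Function.Injective (algebraMap P (FractionRing P)) :=
    IsFractionRing.injective P (FractionRing P)
  have hgen : pfaffian (genericAlternating n) ^ 2 = (genericAlternating n).det := by
    have : CharZero (FractionRing P) := (algebraMap P (FractionRing P)).charZero_iff hinj |>.1
      inferInstance
    apply hinj
    rw [map_pow, ← pfaffian_map, RingHom.map_det, RingHom.mapMatrix_apply]
    apply pfaffian_sq_of_det_ne_zero
    · intro k l
      simp only [Matrix.map_apply]
      rw [genericAlternating_neg_swap, map_neg]
    · rw [← RingHom.mapMatrix_apply, ← RingHom.map_det]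
      exact (map_ne_zero_iff _ hinj).2 hdet
  have := congrArg (MvPolynomial.eval₂Hom (Int.castRingHom R) fun p => A p.1 p.2) hgen
  rwa [map_pow, ← pfaffian_map, RingHom.map_det, RingHom.mapMatrix_apply,
    genericAlternating_map hA hA'] at this

end PfaffianSq

/-! ### The square of `psi` is the characteristic polynomial -/

theorem psi_sq {F W : Type*} [Field F] [AddCommGroup W] [Module F W] [FiniteDimensional F W]
    (ω : LinearMap.BilinForm F W) (hω : IsSymplectic ω) {A : Module.End F W}
    (hA : ∀ v, ω v (A v) = 0) : psi ω hω A ^ 2 = A.charpoly := by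
  have hskew : ∀ v w, ω v (A w) = -ω w (A v) := fun v w =>
    neg_swap (ω := ω.compl₂ A) (by simpa using hA) v w
  let b := (exists_symplecticBasis ω hω).choose
  have hb : IsSymplecticFamily ω b := (exists_symplecticBasis ω hω).choose_spec
  let e : Fin (Module.finrank F W / 2) ⊕ Fin (Module.finrank F W / 2) ≃
      Fin (Module.finrank F W / 2) × Fin 2 :=
    { toFun := Sum.elim (fun i => (i, 0)) fun i => (i, 1)
      invFun := fun k => if k.2 = 0 then Sum.inl k.1 else Sum.inr k.1
      left_inv := by rintro (i | i) <;> simp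
      right_inv := by rintro ⟨i, c⟩; fin_cases c <;> simp }
  let v := b.reindex e
  have hv : ∀ k, v k = interleave b k := by
    rintro ⟨i, c⟩
    fin_cases c <;> simp [v, interleave, e]
  have hgram : ∀ k l, ω (v k) (v l) = stdGram F _ k l := fun k l => by
    rw [hv, hv, hb.gram_interleave hω.alt]
  let G := stdGram F (Module.finrank F W / 2)
  let T : Matrix (Fin (Module.finrank F W / 2) × Fin 2) (Fin (Module.finrank F W / 2) × Fin 2) F :=
    LinearMap.toMatrix v v A
  have hT : ∀ k l, ω (v k) (A (v l)) = (G * T) k l := by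
    intro k l
    conv_lhs => rw [← v.sum_repr (A (v l))]
    simp only [map_sum, map_smul, hgram, smul_eq_mul, Matrix.mul_apply, T, G,
      LinearMap.toMatrix_apply, mul_comm]
  have hmat : (Matrix.of fun k l => C (ω (v k) (A (v l))) - X * C (ω (v k) (v l))) =
      -(G.map C * T.charmatrix) := by
    ext1 k l
    rw [Matrix.charmatrix, mul_sub, ← RingHom.mapMatrix_apply, ← map_mul, neg_sub,
      Matrix.sub_apply, Matrix.scalar_apply, Matrix.mul_diagonal, RingHom.mapMatrix_apply,
      RingHom.mapMatrix_apply, Matrix.map_apply, Matrix.map_apply, Matrix.of_apply, hT, hgram,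
      mul_comm]
  have hpsi : psi ω hω A =
      pfaffian (Matrix.of fun k l => C (ω (v k) (A (v l))) - X * C (ω (v k) (v l))) := by
    simp only [hv]
    rfl
  rw [hpsi, pfaffian_sq, hmat, Matrix.det_neg, Matrix.det_mul, ← RingHom.mapMatrix_apply,
    ← RingHom.map_det, det_stdGram, ← LinearMap.charpoly_toMatrix A v, Matrix.charpoly]
  · simp [T]
  · intro k l
    simp only [Matrix.of_apply]
    rw [hskew (v k), neg_swap hω.alt (v k)]
    simp
    ring
  · simp [hA, hω.alt]

/-! ### Two-dimensional generalized eigenspaces of self-adjoint endomorphisms -/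

section Eigenspaces

variable {F W : Type*} [Field F] [AddCommGroup W] [Module F W]

/-- `T` is self-adjoint for `ω` and the form `ω(·, T ·)` is alternating. When `ω` is
alternating the first condition follows from the second. -/
structure IsAltSelfAdjoint (ω : LinearMap.BilinForm F W) (T : Module.End F W) : Prop where
  adj : ∀ v w, ω (T v) w = ω v (T w)
  alt : ∀ v, ω v (T v) = 0

namespace IsAltSelfAdjoint

variable {ω : LinearMap.BilinForm F W} {S T : Module.End F W}

theorem one (h : ∀ v, ω v v = 0) : IsAltSelfAdjoint ω 1 := ⟨fun _ _ => rfl, h⟩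

theorem add (hS : IsAltSelfAdjoint ω S) (hT : IsAltSelfAdjoint ω T) :
    IsAltSelfAdjoint ω (S + T) :=
  ⟨fun v w => by simp [hS.adj, hT.adj], fun v => by simp [hS.alt, hT.alt]⟩

theorem smul (c : F) (hT : IsAltSelfAdjoint ω T) : IsAltSelfAdjoint ω (c • T) :=
  ⟨fun v w => by simp [hT.adj], fun v => by simp [hT.alt]⟩

theorem adj_pow (hT : IsAltSelfAdjoint ω T) (k : ℕ) (v w : W) :
    ω ((T ^ k) v) w = ω v ((T ^ k) w) := by
  induction k generalizing w with
  | zero => simp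
  | succ k ih => rw [pow_succ', Module.End.mul_apply, hT.adj, ih, ← Module.End.mul_apply,
      ← pow_succ, pow_succ']

/-- A two-dimensional generalized eigenspace of `A` is non-degenerate, because its Fitting
complement is orthogonal to it. An endomorphism `T` of the kind considered that preserves it is
then scalar on it: `ω v (T v) = 0` forces `T v` to be a multiple of `v`. -/
theorem exists_pair_of_finrank_eq_two [FiniteDimensional F W] {A : Module.End F W}
    (hω : IsSymplectic ω) (hA : IsAltSelfAdjoint ω A) {q : F}
    (hq : Module.finrank F (A.maxGenEigenspace q) = 2) :
    ∃ u v, ω u v ≠ 0 ∧ A u = q • u ∧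
      ∀ T, Commute A T → IsAltSelfAdjoint ω T → ∃ a : F, T u = a • u ∧ T v = a • v := by
  have hB : IsAltSelfAdjoint ω (A - q • 1) := by
    simpa [sub_eq_add_neg] using hA.add ((one hω.alt).smul (-q))
  have hU : ∀ x, x ∈ A.maxGenEigenspace q ↔ ∃ k : ℕ, ((A - q • 1) ^ k) x = 0 :=
    fun x => Module.End.mem_maxGenEigenspace A q x
  obtain ⟨u, hu, hu0⟩ := (Submodule.ne_bot_iff (A.maxGenEigenspace q)).1 (by
    intro h
    rw [h, finrank_bot] at hq
    omega)
  have hskew := neg_swap hω.alt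
  obtain ⟨w, hw⟩ : ∃ w, ω u w ≠ 0 := by
    by_contra! hcon
    apply hu0
    apply hω.flat_bijective.1
    ext w
    simp [hskew w, hcon w]
  obtain ⟨m, hm⟩ := Filter.eventually_atTop.1 (A - q • 1).eventually_isCompl_ker_pow_range_pow
  obtain ⟨l, hl⟩ := (hU u).1 hu
  have hcompl := hm (m + l) (by omega)
  have hl' : ((A - q • 1) ^ (m + l)) u = 0 := by
    rw [pow_add, Module.End.mul_apply, hl, map_zero]
  -- Only the component of `w` in the generalized eigenspace pairs with `u`.
  obtain ⟨v, hv, -, ⟨z, rfl⟩, rfl⟩ := Submodule.mem_sup.1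
    (hcompl.sup_eq_top.ge (Submodule.mem_top (x := w)))
  have huv : ω u v ≠ 0 := by
    rwa [map_add, ← hB.adj_pow, hl', map_zero, LinearMap.zero_apply, add_zero] at hw
  have hvU : v ∈ A.maxGenEigenspace q := (hU v).2 ⟨_, hv⟩
  have hli : LinearIndependent F ![u, v] := by
    rw [LinearIndependent.pair_iff]
    intro s t hst
    have h1 := congrArg (fun x => ω u x) hst
    have h2 := congrArg (fun x => ω x v) hst
    simpa [hω.alt, huv] using And.intro h2 h1
  have hspan : Submodule.span F {u, v} = A.maxGenEigenspace q := by
    apply Submodule.eq_of_le_of_finrank_eq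
    · rw [Submodule.span_le]
      rintro x (rfl | rfl) <;> assumption
    · rw [hq]
      have := finrank_span_eq_card hli
      rwa [Matrix.range_cons_cons_empty, Fintype.card_fin] at this
  have key : ∀ T, Commute A T → IsAltSelfAdjoint ω T → ∃ a : F, T u = a • u ∧ T v = a • v := by
    intro T hAT hT
    have hmaps : ∀ x ∈ A.maxGenEigenspace q, T x ∈ Submodule.span F {u, v} := fun x hx =>
      hspan ▸ Module.End.mapsTo_maxGenEigenspace_of_comm hAT q hx
    obtain ⟨a, b, hab⟩ := Submodule.mem_span_pair.1 (hmaps u hu)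
    obtain ⟨c, d, hcd⟩ := Submodule.mem_span_pair.1 (hmaps v hvU)
    have hb : b = 0 := by
      have := hT.alt u
      rw [← hab] at this
      simpa [hω.alt, huv] using this
    have hc : c = 0 := by
      have := hT.alt v
      rw [← hcd] at this
      simpa [hω.alt, hskew v u, huv] using this
    have had : a = d := by
      have := hT.adj u v
      rw [← hab, ← hcd] at this
      simpa [hω.alt, huv] using this
    refine ⟨a, by rw [← hab, hb, zero_smul, add_zero], ?_⟩
    rw [← hcd, hc, zero_smul, zero_add, had]
  refine ⟨u, v, huv, ?_, key⟩
  obtain ⟨a, ha, -⟩ := key A (Commute.refl A) hA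
  rw [ha]
  by_cases haq : a = q
  · rw [haq]
  · refine absurd ?_ hu0
    exact Submodule.disjoint_def.1 (Module.End.disjoint_genEigenspace A haq 1 ⊤) u
      (Module.End.mem_eigenspace_iff.2 ha) hu

end IsAltSelfAdjoint

end Eigenspaces

theorem rootMultiplicity_prod_sub_sq {F : Type*} [Field F] {n : ℕ} {q : Fin n → F}
    (hq : Function.Injective q) (i : Fin n) :
    ((∏ j, (C (q j) - X)) ^ 2).rootMultiplicity (q i) = 2 := by
  classical
  have h1 : (∏ j, (C (q j) - X)) ^ 2 =
      ((Finset.univ.val.map q).map fun a => X - C a).prod ^ 2 := by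
    rw [Multiset.map_map, Finset.prod_map_val, ← Finset.prod_pow, ← Finset.prod_pow]
    exact Finset.prod_congr rfl fun j _ => by simp only [Function.comp_apply]; ring
  rw [h1, ← count_roots, roots_pow, roots_multiset_prod_X_sub_C, Multiset.count_nsmul,
    Multiset.count_eq_one_of_mem ((Multiset.nodup_map_iff_of_injective hq).2 Finset.univ.nodup)
      (Multiset.mem_map_of_mem q (Finset.mem_univ i))]

/-! ### Extension of scalars -/

section BaseChange

variable {K V : Type*} (L : Type*) [Field K] [Field L] [Algebra K L] [AddCommGroup V] [Module K V]

theorem baseChange_alternating {β : LinearMap.BilinForm K V} (h : ∀ v, β v v = 0)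
    (x : L ⊗[K] V) : β.baseChange L x x = 0 := by
  have hskew : ∀ x y : L ⊗[K] V, β.baseChange L x y = -β.baseChange L y x := by
    intro x y
    induction x with
    | zero => simp
    | add x₁ x₂ h₁ h₂ => simp only [map_add, LinearMap.add_apply, h₁, h₂, neg_add]
    | tmul a v =>
      induction y with
      | zero => simp
      | add y₁ y₂ h₁ h₂ => simp only [map_add, LinearMap.add_apply, h₁, h₂, neg_add]
      | tmul c w =>
        rw [LinearMap.BilinForm.baseChange_tmul, LinearMap.BilinForm.baseChange_tmul,
          neg_swap h v w, neg_smul, mul_comm a c]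
  induction x with
  | zero => simp
  | add x₁ x₂ h₁ h₂ => simp [h₁, h₂, hskew x₁ x₂]
  | tmul a v => rw [LinearMap.BilinForm.baseChange_tmul, h, zero_smul]

theorem IsAltSelfAdjoint.baseChange {ω : LinearMap.BilinForm K V} {T : Module.End K V}
    (hT : IsAltSelfAdjoint ω T) : IsAltSelfAdjoint (ω.baseChange L) (T.baseChange L) := by
  refine ⟨fun x y => ?_, fun x => ?_⟩
  · induction x with
    | zero => simp
    | add x₁ x₂ h₁ h₂ => simp only [map_add, LinearMap.add_apply, h₁, h₂]
    | tmul a v =>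
      induction y with
      | zero => simp
      | add y₁ y₂ h₁ h₂ => simp only [map_add, h₁, h₂]
      | tmul c w => simp only [LinearMap.baseChange_tmul, LinearMap.BilinForm.baseChange_tmul,
          hT.adj]
  · have h : ∀ x y, ω.baseChange L x (T.baseChange L y) =
        LinearMap.BilinForm.baseChange L (ω.compl₂ T) x y := by
      intro x y
      induction x with
      | zero => simp
      | add x₁ x₂ h₁ h₂ => simp only [map_add, LinearMap.add_apply, h₁, h₂]
      | tmul a v =>
        induction y with
        | zero => simp
        | add y₁ y₂ h₁ h₂ => simp only [map_add, h₁, h₂]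
        | tmul c w => simp only [LinearMap.baseChange_tmul, LinearMap.BilinForm.baseChange_tmul,
            LinearMap.compl₂_apply]
    rw [h]
    exact baseChange_alternating L (by simpa using hT.alt) x

/-- If the extended form is nonzero on the common kernel of the extensions of `f` and `g`, then the
form is already nonzero on the common kernel of `f` and `g`, since that kernel commutes with the
extension of scalars. -/
theorem exists_ne_zero_of_baseChange {ω : LinearMap.BilinForm K V} {f g : Module.End K V}
    {x y : L ⊗[K] V} (hfx : f.baseChange L x = 0) (hgx : g.baseChange L x = 0)
    (hfy : f.baseChange L y = 0) (hgy : g.baseChange L y = 0) (hxy : ω.baseChange L x y ≠ 0) :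
    ∃ v w, (f v = 0 ∧ g v = 0) ∧ (f w = 0 ∧ g w = 0) ∧ ω v w ≠ 0 := by
  let p : V →ₗ[K] V × V := f.prod g
  have hker : ∀ x : L ⊗[K] V, f.baseChange L x = 0 → g.baseChange L x = 0 →
      ∃ x' : L ⊗[K] LinearMap.ker p, (LinearMap.ker p).subtype.baseChange L x' = x := by
    intro x hf hg
    have hp : p = LinearMap.inl K V V ∘ₗ f + LinearMap.inr K V V ∘ₗ g := by
      ext v <;> simp [p]
    have hpx : p.baseChange L x = 0 := by
      rw [hp, LinearMap.baseChange_add, LinearMap.baseChange_comp, LinearMap.baseChange_comp]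
      simp [hf, hg]
    have := Module.Flat.ker_lTensor_eq (R := K) L L p
    exact (this ▸ LinearMap.mem_ker.2 hpx :
      x ∈ LinearMap.range (AlgebraTensorModule.lTensor L L (LinearMap.ker p).subtype))
  obtain ⟨x, rfl⟩ := hker x hfx hgx
  obtain ⟨y, rfl⟩ := hker y hfy hgy
  by_contra! hcon
  apply hxy
  have hp : ∀ v : LinearMap.ker p, f v = 0 ∧ g v = 0 := fun v =>
    Prod.mk_eq_zero.1 (LinearMap.mem_ker.1 v.2)
  clear hxy hfx hgx hfy hgy
  induction x with
  | zero => simp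
  | add x₁ x₂ h₁ h₂ => simp only [map_add, LinearMap.add_apply, h₁, h₂, add_zero]
  | tmul a v =>
    induction y with
    | zero => simp
    | add y₁ y₂ h₁ h₂ => simp only [map_add, h₁, h₂, add_zero]
    | tmul c w =>
      rw [LinearMap.baseChange_tmul, LinearMap.baseChange_tmul,
        LinearMap.BilinForm.baseChange_tmul, Submodule.subtype_apply, Submodule.subtype_apply,
        hcon v w (hp v) (hp w), zero_smul]

end BaseChange

/-- An eigenvalue in `K(s)` of an endomorphism defined over `K` is algebraic over `K`, hence lies
in `K`. -/
theorem exists_eq_C_of_baseChange_apply {K V : Type*} [Field K] [AddCommGroup V] [Module K V]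
    [FiniteDimensional K V] {T : Module.End K V} {a : RatFunc K} {u : RatFunc K ⊗[K] V}
    (hu : u ≠ 0) (h : T.baseChange (RatFunc K) u = a • u) : ∃ c, a = RatFunc.C c := by
  by_contra hcon
  apply RatFunc.transcendental_of_ne_C a hcon
  refine ⟨T.charpoly, T.charpoly_monic.ne_zero, ?_⟩
  have hev : Module.End.HasEigenvalue (T.baseChange (RatFunc K)) a :=
    Module.End.hasEigenvalue_of_hasEigenvector (Module.End.hasEigenvector_iff.2
      ⟨Module.End.mem_eigenspace_iff.2 h, hu⟩)
  have := (Module.End.hasEigenvalue_iff_isRoot_charpoly _ _).1 hev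
  rwa [LinearMap.charpoly_baseChange, Polynomial.IsRoot.def, eval_map_algebraMap] at this

theorem eq_of_sub_X_mul_eq {K : Type*} [Field K] {a b c d : K}
    (h : (RatFunc.C a - RatFunc.X * RatFunc.C b : RatFunc K) =
      RatFunc.C c - RatFunc.X * RatFunc.C d) : a = c ∧ b = d := by
  have h1 : (C a - X * C b : K[X]) = C c - X * C d := by
    apply RatFunc.algebraMap_injective
    simpa only [map_sub, map_mul, RatFunc.algebraMap_C, RatFunc.algebraMap_X] using h
  constructor
  · simpa using congrArg (fun p => p.coeff 0) h1
  · simpa using congrArg (fun p => p.coeff 1) h1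

/-! ### Symplectically normal endomorphisms -/

section Normal

variable {K V : Type*} [Field K] [AddCommGroup V] [Module K V]
  {ω : LinearMap.BilinForm K V} (hω : IsSymplectic ω) (M : Module.End K V)

theorem apply_symplAdjoint_left (v w : V) : ω (symplAdjoint ω hω M v) w = ω v (M w) := by
  rw [neg_swap hω.alt, ← apply_symplAdjoint, ← neg_swap hω.alt]

theorem isAltSelfAdjoint_mul : IsAltSelfAdjoint ω (M * symplAdjoint ω hω M) := by
  refine ⟨fun v w => ?_, fun v => ?_⟩
  · rw [Module.End.mul_apply, apply_symplAdjoint, apply_symplAdjoint_left, Module.End.mul_apply]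
  · rw [Module.End.mul_apply, ← apply_symplAdjoint_left hω, hω.alt]

theorem isAltSelfAdjoint_add : IsAltSelfAdjoint ω (M + symplAdjoint ω hω M) := by
  refine ⟨fun v w => ?_, fun v => ?_⟩
  · rw [LinearMap.add_apply, LinearMap.add_apply, map_add, map_add, LinearMap.add_apply,
      apply_symplAdjoint, apply_symplAdjoint_left, add_comm]
  · rw [LinearMap.add_apply, map_add, ← apply_symplAdjoint, neg_swap hω.alt (M v), add_neg_cancel]

theorem symplPencil_eq [FiniteDimensional K V] : symplPencil ω hω M =
    (M * symplAdjoint ω hω M).baseChange (RatFunc K) +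
      (-RatFunc.X : RatFunc K) • (M + symplAdjoint ω hω M).baseChange (RatFunc K) +
      (RatFunc.X ^ 2 : RatFunc K) • 1 := by
  refine LinearMap.ext fun x => ?_
  rw [Module.End.mul_eq_comp, LinearMap.baseChange_comp, LinearMap.baseChange_add]
  change LinearMap.baseChange (RatFunc K) M
        (LinearMap.baseChange (RatFunc K) (symplAdjoint ω hω M) x - (RatFunc.X : RatFunc K) • x) -
      (RatFunc.X : RatFunc K) • (LinearMap.baseChange (RatFunc K) (symplAdjoint ω hω M) x -
        (RatFunc.X : RatFunc K) • x) =
    LinearMap.baseChange (RatFunc K) M (LinearMap.baseChange (RatFunc K) (symplAdjoint ω hω M) x) +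
      (-RatFunc.X : RatFunc K) • (LinearMap.baseChange (RatFunc K) M x +
        LinearMap.baseChange (RatFunc K) (symplAdjoint ω hω M) x) +
      (RatFunc.X ^ 2 : RatFunc K) • x
  rw [map_sub, map_smul, pow_two, mul_smul, neg_smul, smul_sub, smul_add]
  abel

variable {M}

/-- The joint eigenspace of `M * M^{*ω}` and `M + M^{*ω}` attached to a factor of the symplectic
characteristic polynomial is not isotropic. On the eigenspace of the pencil over `K(s)` the two
operators have eigenvalues in `K`, which can be read off from the eigenvalue `(λ - s)(μ - s)`. -/
theorem exists_pair_of_symplCharpoly [FiniteDimensional K V] (hM : IsSymplecticallyNormal ω hω M)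
    {n : ℕ} {lam mu : Fin n → K}
    (hchar : symplCharpoly ω hω M = ∏ i, (C (quad (lam i) (mu i)) - X))
    (hdist : Function.Injective fun i => quad (lam i) (mu i)) (i : Fin n) :
    ∃ v w,
      ((M * symplAdjoint ω hω M) v = (lam i * mu i) • v ∧
        (M + symplAdjoint ω hω M) v = (lam i + mu i) • v) ∧
      ((M * symplAdjoint ω hω M) w = (lam i * mu i) • w ∧
        (M + symplAdjoint ω hω M) w = (lam i + mu i) • w) ∧ ω v w ≠ 0 := by
  set N := M * symplAdjoint ω hω M with hN
  set P := M + symplAdjoint ω hω M with hP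
  have hNP : Commute N P := by
    have h : M * symplAdjoint ω hω M = symplAdjoint ω hω M * M := hM
    have h' : Commute M (symplAdjoint ω hω M) := h
    exact ((Commute.refl M).add_right h').mul_left (h'.symm.add_right (Commute.refl _))
  have hNs : IsAltSelfAdjoint ω N := isAltSelfAdjoint_mul hω M
  have hPs : IsAltSelfAdjoint ω P := isAltSelfAdjoint_add hω M
  have hω' := hω.baseChange (RatFunc K)
  have hNL := hNs.baseChange (RatFunc K)
  have hPL := hPs.baseChange (RatFunc K)
  have hA := symplPencil_eq hω M
  rw [← hN, ← hP] at hA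
  set A := symplPencil ω hω M with hAdef
  have hAs : IsAltSelfAdjoint (ω.baseChange (RatFunc K)) A := by
    rw [hA]
    exact (hNL.add (hPL.smul _)).add ((IsAltSelfAdjoint.one hω'.alt).smul _)
  have hdim : Module.finrank (RatFunc K) (A.maxGenEigenspace (quad (lam i) (mu i))) = 2 := by
    rw [LinearMap.finrank_maxGenEigenspace_eq, ← psi_sq _ hω' hAs.alt]
    have : psi (ω.baseChange (RatFunc K)) hω' A = _ := hchar
    rw [this]
    exact rootMultiplicity_prod_sub_sq hdist i
  have hcommL : Commute (N.baseChange (RatFunc K)) (P.baseChange (RatFunc K)) := by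
    rw [Commute, SemiconjBy, Module.End.mul_eq_comp, Module.End.mul_eq_comp,
      ← LinearMap.baseChange_comp, ← LinearMap.baseChange_comp, ← Module.End.mul_eq_comp,
      ← Module.End.mul_eq_comp, hNP.eq]
  obtain ⟨u, v, huv, hu, key⟩ := hAs.exists_pair_of_finrank_eq_two hω' hdim
  obtain ⟨a, hau, hav⟩ := key (N.baseChange (RatFunc K)) (by
    rw [hA]
    exact ((Commute.refl _).add_left (hcommL.symm.smul_left _)).add_left
      ((Commute.one_left _).smul_left _)) hNL
  obtain ⟨d, hdu, hdv⟩ := key (P.baseChange (RatFunc K)) (by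
    rw [hA]
    exact (hcommL.add_left ((Commute.refl _).smul_left _)).add_left
      ((Commute.one_left _).smul_left _)) hPL
  have hu0 : u ≠ 0 := by
    rintro rfl
    simp at huv
  obtain ⟨a, rfl⟩ := exists_eq_C_of_baseChange_apply hu0 hau
  obtain ⟨d, rfl⟩ := exists_eq_C_of_baseChange_apply hu0 hdu
  have hquad : RatFunc.C a - RatFunc.X * RatFunc.C d + RatFunc.X ^ 2 = quad (lam i) (mu i) := by
    rw [hA] at hu
    simp only [LinearMap.add_apply, LinearMap.smul_apply, Module.End.one_apply, hau, hdu, smul_smul,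
      ← add_smul] at hu
    rw [← smul_left_injective _ hu0 hu]
    ring
  obtain ⟨rfl, rfl⟩ : a = lam i * mu i ∧ d = lam i + mu i := by
    apply eq_of_sub_X_mul_eq
    rw [quad] at hquad
    rw [map_mul, map_add]
    linear_combination hquad
  have hsub : ∀ (T : Module.End K V) (c : K) (x : RatFunc K ⊗[K] V),
      T.baseChange (RatFunc K) x = RatFunc.C c • x →
        (T - c • 1).baseChange (RatFunc K) x = 0 := by
    intro T c x hx
    rw [LinearMap.baseChange_sub, LinearMap.baseChange_smul, LinearMap.sub_apply, hx]
    have : c • x = RatFunc.C c • x := (algebraMap_smul (RatFunc K) c x).symm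
    simp [Module.End.one_eq_id, this]
  have h := exists_ne_zero_of_baseChange (RatFunc K) (hsub _ _ _ hau) (hsub _ _ _ hdu)
    (hsub _ _ _ hav) (hsub _ _ _ hdv) huv
  simpa [sub_eq_zero] using h

end Normal

end SymplLin

end

theorem mainTheorem4 {K V : Type*} [Field K] [AddCommGroup V] [Module K V] [FiniteDimensional K V]
    (n : ℕ) (hn : Module.finrank K V = 2 * n)
    (ω : LinearMap.BilinForm K V) (hω : SymplLin.IsSymplectic ω)
    (M : Module.End K V) (hM : SymplLin.IsSymplecticallyNormal ω hω M)
    (lam mu : Fin n → K)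
    (hchar : SymplLin.symplCharpoly ω hω M =
      ∏ i, (Polynomial.C (SymplLin.quad (lam i) (mu i)) - Polynomial.X))
    (hdist : ∀ i j, i ≠ j → SymplLin.quad (lam i) (mu i) ≠ SymplLin.quad (lam j) (mu j)) :
    ∃ b : Module.Basis (Fin n ⊕ Fin n) K V, SymplLin.IsSymplecticFamily ω b ∧
      ∀ i,
        (M * SymplLin.symplAdjoint ω hω M) (b (Sum.inl i)) = (lam i * mu i) • b (Sum.inl i) ∧
        (M + SymplLin.symplAdjoint ω hω M) (b (Sum.inl i)) = (lam i + mu i) • b (Sum.inl i) ∧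
        (M * SymplLin.symplAdjoint ω hω M) (b (Sum.inr i)) = (lam i * mu i) • b (Sum.inr i) ∧
        (M + SymplLin.symplAdjoint ω hω M) (b (Sum.inr i)) = (lam i + mu i) • b (Sum.inr i) := by
  choose e f he hf hef using SymplLin.exists_pair_of_symplCharpoly hω hM hchar
    fun i j hij => by_contra fun h => hdist i j h hij
  -- Joint eigenspaces for different indices are orthogonal: one of the two eigenvalues differs.
  have horth : ∀ i j, i ≠ j → ∀ v w,
      ((M * SymplLin.symplAdjoint ω hω M) v = (lam i * mu i) • v ∧
        (M + SymplLin.symplAdjoint ω hω M) v = (lam i + mu i) • v) →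
      ((M * SymplLin.symplAdjoint ω hω M) w = (lam j * mu j) • w ∧
        (M + SymplLin.symplAdjoint ω hω M) w = (lam j + mu j) • w) → ω v w = 0 := by
    intro i j hij v w hv hw
    by_contra hvw
    have h1 := (SymplLin.isAltSelfAdjoint_mul hω M).adj v w
    have h2 := (SymplLin.isAltSelfAdjoint_add hω M).adj v w
    rw [hv.1, hw.1, map_smul, map_smul, LinearMap.smul_apply, smul_eq_mul, smul_eq_mul] at h1
    rw [hv.2, hw.2, map_smul, map_smul, LinearMap.smul_apply, smul_eq_mul, smul_eq_mul] at h2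
    have h1 := congrArg RatFunc.C (mul_right_cancel₀ hvw h1)
    have h2 := congrArg RatFunc.C (mul_right_cancel₀ hvw h2)
    rw [map_mul, map_mul] at h1
    rw [map_add, map_add] at h2
    apply hdist i j hij
    rw [SymplLin.quad, SymplLin.quad]
    linear_combination h1 - RatFunc.X * h2
  let b : Fin n ⊕ Fin n → V := Sum.elim e fun i => (ω (e i) (f i))⁻¹ • f i
  have hb : SymplLin.IsSymplecticFamily ω b := by
    refine ⟨fun i j => ?_, fun i j => ?_, fun i j => ?_⟩ <;> by_cases hij : i = j
    · simp [b, hij, hω.alt]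
    · exact horth i j hij _ _ (he i) (he j)
    · simp [b, hij, hω.alt]
    · simp [b, horth i j hij _ _ (hf i) (hf j)]
    · subst hij
      simp [b, hef]
    · simp [b, hij, horth i j hij _ _ (he i) (hf j)]
  have hbasis : ∀ k, basisOfLinearIndependentOfCardEqFinrank' b (hb.linearIndependent hω.alt)
      (by simp [hn, two_mul]) k = b k := fun k => by simp
  refine ⟨basisOfLinearIndependentOfCardEqFinrank' b (hb.linearIndependent hω.alt)
    (by simp [hn, two_mul]), ?_, fun i => ?_⟩
  · simpa using hb
  · simp only [hbasis]
    refine ⟨(he i).1, (he i).2, ?_, ?_⟩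
    · change _ = (lam i * mu i) • ((ω (e i) (f i))⁻¹ • f i)
      rw [smul_comm, ← (hf i).1, ← map_smul]
      rfl
    · change _ = (lam i + mu i) • ((ω (e i) (f i))⁻¹ • f i)
      rw [smul_comm, ← (hf i).2, ← map_smul]
      rfl
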